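/- **Setting.** Let $\mathcal G=(\mathcal V,\mathcal E)$ be a finite directed graph with vertices $v_{\rm source},v_{\rm target}$. Each edge $e$ has a lazy estimate $\hat w(e)\in(0,\infty)$ and a true weight $w(e)$, where $w(e)=\hat w(e)$ if $e$ is not in collision and $w(e)=\infty$ if $e$ is in collision. *Evaluating* $e$ means computing $w(e)$. The lazy cost of a path is the sum of the lazy estimates of its edges. Assume that no two distinct simple paths starting at $v_{\rm source}$ have the same lazy cost. **The algorithm LRA\*** with lookahead $\alpha\in\{1,2,\dots\}\cup\{\infty\}$ maintains a search tree $\mathcal T$ rooted at $v_{\rm source}$, with at most one node per vertex. The tree path to a node consists of a head (evaluated, collision-free edges) followed by a tail (unevaluated edges). The *key* of a node is the cost of the head plus the lazy cost of the tail, and its *budget* is the number of edges of the tail. A node is a *frontier node* if its budget equals $\alpha$ or its vertex is $v_{\rm target}$. *Extending the band:* as long as there is an edge $(u,v)$ of the current graph such that $u\ne v_{\rm target}$ is in $\mathcal T$ with budget $<\alpha$, and $v$ either is not in $\mathcal T$ or would get a strictly smaller key with $u$ as its parent, choose such an edge and make $u$ the parent of $v$; if $v$ was already in $\mathcal T$,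 its old subtree is removed. Start with $\mathcal T=\{v_{\rm source}\}$, with key and budget $0$, and extend the band. Then repeat the following until $v_{\rm target}$ is in $\mathcal T$ with budget $0$ (the target is reached) or there is no frontier node (failure). Choose a frontier node with minimal key and evaluate the first edge $(u,v)$ of the tail of its tree path. If $(u,v)$ is not in collision, it moves from the tail to the head of the paths to $v$ and to all its descendants. If it is in collision, it is removed from the graph and the subtree rooted at $v$ is detached. Unless $v_{\rm target}$ has been reached, extend the band again (this includes rewiring the detached vertices to new parents). **Lemma.** For every such problem and all lookaheads $\alpha_1>\alpha_2\ge 1$ (where $\alpha_1=\infty$ is allowed), LRA\* has complete (finite, stopped) executions with lookahead $\alpha_1$ and with lookahead $\alpha_2$, and $$E_1\subseteq E_2$$ whenever $E_i$ is the set of edges evaluated in a complete execution of LRA\* with lookahead $\alpha_i$, $i\in\{1,2\}$, whatever order was chosen for the extension steps. Thus a larger lookahead never causes more edge evaluations. -/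

import Mathlib

/-- A shortest-path problem on a directed graph with vertex type `V`: the edges, the lazy estimate
`lazyW` of the edge weights, the true weight function `w`, and the source and target vertices.
Lazy estimates are positive; the true weight of an edge equals its lazy estimate
if the edge is not in collision, and is infinite if the edge is in collision. -/
structure ShortestPathProblem (V : Type*) where
  edges : Set (V × V)
  lazyW : V × V → ℝ
  w : V × V → WithTop ℝ
  source : V
  target : V
  lazyW_pos : ∀ e ∈ edges, 0 < lazyW e
  w_eq : ∀ e ∈ edges, w e = (lazyW e : WithTop ℝ) ∨ w e = ⊤

namespace ShortestPathProblem

variable {V : Type*}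

/-- The list of vertices `p` is a simple path of the graph that starts at the source. -/
def IsPathFromSource (P : ShortestPathProblem V) (p : List V) : Prop :=
  p.head? = some P.source ∧ p.Nodup ∧ p.IsChain (fun x y => (x, y) ∈ P.edges)

/-- The lazy cost of a path: the sum of the lazy estimates of its edges. -/
def lazyCost (P : ShortestPathProblem V) (p : List V) : ℝ :=
  ((p.zip p.tail).map P.lazyW).sum

/-- No two different simple paths from the source have the same lazy cost. -/
def NoTies (P : ShortestPathProblem V) : Prop :=
  ∀ p q : List V, P.IsPathFromSource p → P.IsPathFromSource q →
    P.lazyCost p = P.lazyCost q → p = q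

end ShortestPathProblem

namespace LRAStar

/-- The entry of a node of the search tree: its parent (`none` for the root), the cost `c` of the
evaluated part (head) of its tree path, the lazy cost `l` of the part of its tree path that is not
evaluated (tail), and its budget `b`, the number of edges of the tail. -/
structure Node (V : Type*) where
  parent : Option V
  c : ℝ
  l : ℝ
  b : ℕ

/-- The estimated cost-to-come of a node. -/
def Node.key {V : Type*} (n : Node V) : ℝ := n.c + n.l

/-- A state of the algorithm: the edges still in the graph, the edges evaluated so far, and the
search tree, with at most one node for each vertex. -/
structure State (V : Type*) where
  edges : Set (V × V)
  evaluated : Set (V × V)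
  tree : V → Option (Node V)

variable {V : Type*}

/-- The vertices of the subtree of the search tree that is rooted at `v`. -/
def State.subtree (s : State V) (v : V) : Set V :=
  {x | Relation.ReflTransGen (fun y z => ∃ n, s.tree z = some n ∧ n.parent = some y) v x}

open Classical in
/-- The initial state: nothing is evaluated, and the search tree consists of the source. -/
noncomputable def init (P : ShortestPathProblem V) : State V where
  edges := P.edges
  evaluated := ∅
  tree := fun x => if x = P.source then some ⟨none, 0, 0, 0⟩ else none

/-- The edge `(u, v)` asks for an extension of the search tree through `u`: the node of `u` is in
the tree, is not the target, has budget less than the lookahead, and `v` either is not in the tree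
or would get a smaller key with `u` as its parent. -/
def CanAttach (P : ShortestPathProblem V) (α : ℕ∞) (s : State V) (u v : V) : Prop :=
  ∃ n, s.tree u = some n ∧ u ≠ P.target ∧ (n.b : ℕ∞) < α ∧ (u, v) ∈ s.edges ∧
    ∀ m, s.tree v = some m → n.key + P.lazyW (u, v) < m.key

open Classical in
/-- Make `u` (with entry `n`) the parent of `v`. If `v` is already in the search tree,
then its old subtree is removed. -/
noncomputable def attach (P : ShortestPathProblem V) (s : State V) (u : V) (n : Node V) (v : V) :
    State V :=
  { s with
    tree := fun x =>
      if x = v then some ⟨some u, n.c, n.l + P.lazyW (u, v), n.b + 1⟩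
      else if x ∈ s.subtree v then none
      else s.tree x }

/-- One elementary step of rewiring or of extending the lazy band. -/
def AttachStep (P : ShortestPathProblem V) (α : ℕ∞) (s s' : State V) : Prop :=
  ∃ u v n, s.tree u = some n ∧ CanAttach P α s u v ∧ s' = attach P s u n v

/-- `s'` arises from `s` by rewiring nodes to better parents and extending the lazy band, in any
order, until no node with budget less than the lookahead is left to be extended. (Rewiring the
detached nodes one after another to their best parents in the tree, and then extending the band
from the node with least key on, is one of these orders.) -/
def ExtendBand (P : ShortestPathProblem V) (α : ℕ∞) (s s' : State V) : Prop :=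
  Relation.ReflTransGen (AttachStep P α) s s' ∧ ∀ u v, ¬ CanAttach P α s' u v

/-- The vertex `x` has a frontier node, with entry `n`: the budget of the node equals the lookahead,
or `x` is the target, which is never extended. -/
def IsFrontier (P : ShortestPathProblem V) (α : ℕ∞) (s : State V) (x : V) (n : Node V) : Prop :=
  s.tree x = some n ∧ ((n.b : ℕ∞) = α ∨ x = P.target)

/-- The frontier node of `x` has minimal key among all frontier nodes. -/
def IsNext (P : ShortestPathProblem V) (α : ℕ∞) (s : State V) (x : V) : Prop :=
  ∃ n, IsFrontier P α s x n ∧ ∀ y m, IsFrontier P α s y m → n.key ≤ m.key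

/-- `(u, v)` is the first edge of the tail of the tree path to `x`: the last vertex on this path
with budget `0` is `u`, and `v` is its successor. -/
def IsFirstTailEdge (s : State V) (x u v : V) : Prop :=
  x ∈ s.subtree v ∧
    ∃ n m, s.tree u = some n ∧ s.tree v = some m ∧ m.parent = some u ∧ n.b = 0 ∧ 0 < m.b

open Classical in
/-- Evaluation of the edge `(u, v)`, where `v` is a child of `u` in the search tree.
If the edge is free of collision, then in the entries of `v` and of all its descendants it moves
from the tail of the path to the head. If it is in collision, then it is removed
from the graph, and the subtree rooted at `v` is detached from the search tree. -/
noncomputable def evaluate (P : ShortestPathProblem V) (s : State V) (u v : V) : State V :=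
  if P.w (u, v) = (P.lazyW (u, v) : WithTop ℝ) then
    { edges := s.edges
      evaluated := insert (u, v) s.evaluated
      tree := fun x =>
        if x ∈ s.subtree v then
          (s.tree x).map fun n =>
            ⟨n.parent, n.c + P.lazyW (u, v), n.l - P.lazyW (u, v), n.b - 1⟩
        else s.tree x }
  else
    { edges := s.edges \ {(u, v)}
      evaluated := insert (u, v) s.evaluated
      tree := fun x => if x ∈ s.subtree v then none else s.tree x }

/-- The target has been reached by a path all of whose edges are evaluated. -/
def Done (P : ShortestPathProblem V) (s : State V) : Prop :=
  ∃ n, s.tree P.target = some n ∧ n.b = 0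

/-- One iteration of the main loop: a frontier node with minimal key is chosen, and the first edge
of the tail of its tree path is evaluated; unless the target is reached by this,
nodes are rewired and the lazy band is extended again. -/
def Iteration (P : ShortestPathProblem V) (α : ℕ∞) (s s' : State V) : Prop :=
  ¬ Done P s ∧ ∃ x u v, IsNext P α s x ∧ IsFirstTailEdge s x u v ∧
    ((Done P (evaluate P s u v) ∧ s' = evaluate P s u v) ∨
      (¬ Done P (evaluate P s u v) ∧ ExtendBand P α (evaluate P s u v) s'))

/-- The algorithm stops in the state `s`: the target has been reached, or there is
no frontier node (failure). -/
def Stops (P : ShortestPathProblem V) (α : ℕ∞) (s : State V) : Prop :=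
  Done P s ∨ ∀ x n, ¬ IsFrontier P α s x n

/-- `E` is the set of the edges evaluated in a complete execution of LRA* with lookahead `α`. -/
def IsEvaluatedSet (P : ShortestPathProblem V) (α : ℕ∞) (E : Set (V × V)) : Prop :=
  ∃ s₀ s, ExtendBand P α (init P) s₀ ∧ Relation.ReflTransGen (Iteration P α) s₀ s ∧
    Stops P α s ∧ s.evaluated = E

end LRAStar

/-!
Call a node optimal if no walk of the current graph from the source to its vertex has lazy cost
smaller than its key. When the band is closed, every walk of the current graph that leaves the tree
passes a frontier node, so all nodes on the tree path to the next frontier node `x` are optimal.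

For the inclusion, let `t` be the final state of an execution with the smaller lookahead, let `s` be
a state of the other execution all of whose evaluated edges are evaluated in `t`, and suppose that
the next edge `(u, v)` of `s`, on the tree path to `x`, is not evaluated in `t`. Follow this path
from `u`. As long as the frontier of `t` is not met, the closed band of `t` contains the next vertex
with at most the same key; as the graph of `t` is contained in that of `s`, optimality makes
the keys equal, and by the absence of ties also the parents. So `t` has a frontier node of positive
budget with key at most that of `x`. Hence `t` has stopped at the target, with a key that is no
larger. The tree path to the target in `t` is a walk in the graph of `s`, so its cost is at
least the key of `x`. All these keys are therefore equal, and the absence of ties identifies the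
frontier node with the target, which has budget `0`: a contradiction.

Extending the band terminates because every step creates a key that is smaller than all the keys
it removes, while all keys are costs of simple paths.
-/

namespace ShortestPathProblem

variable {V : Type*} {P : ShortestPathProblem V} {E F : Set (V × V)} {p : List V} {u v : V} {c : ℝ}

/-- The number `c` is the lazy cost of a walk from the source to `v` with edges in `E`. Such a walk
may repeat vertices, and `E` stands for the edges that are still in the graph of a state. -/
inductive IsWalkCost (P : ShortestPathProblem V) (E : Set (V × V)) : V → ℝ → Prop
  | nil : IsWalkCost P E P.source 0
  | snoc {u v : V} {c : ℝ} :
      IsWalkCost P E u c → (u, v) ∈ E → IsWalkCost P E v (c + P.lazyW (u, v))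

theorem IsWalkCost.mono (hEF : E ⊆ F) (hc : P.IsWalkCost E v c) : P.IsWalkCost F v c := by
  induction hc with
  | nil => exact .nil
  | snoc _ he ih => exact ih.snoc (hEF he)

theorem IsWalkCost.nonneg (hE : E ⊆ P.edges) (hc : P.IsWalkCost E v c) : 0 ≤ c := by
  induction hc with
  | nil => exact le_rfl
  | snoc _ he ih => exact add_nonneg ih (P.lazyW_pos _ (hE he)).le

theorem lazyCost_append_singleton_append_singleton (P : ShortestPathProblem V) (p : List V)
    (u v : V) : P.lazyCost (p ++ [u] ++ [v]) = P.lazyCost (p ++ [u]) + P.lazyW (u, v) := by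
  induction p with
  | nil => simp [lazyCost]
  | cons a p ih =>
    cases p with
    | nil => simp [lazyCost]
    | cons b p =>
      simp only [lazyCost, List.cons_append, List.tail_cons, List.zip_cons_cons, List.map_cons,
        List.sum_cons] at ih ⊢
      rw [ih, add_assoc]

theorem IsPathFromSource.append_singleton (hp : P.IsPathFromSource (p ++ [u]))
    (he : (u, v) ∈ P.edges) (hv : v ∉ p ++ [u]) : P.IsPathFromSource (p ++ [u] ++ [v]) := by
  obtain ⟨hhead, hnodup, hchain⟩ := hp
  refine ⟨?_, hnodup.append (List.nodup_singleton v) (by simpa using hv), ?_⟩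
  · rw [List.head?_append, hhead, Option.some_or]
  · exact List.isChain_append.2 ⟨hchain, List.isChain_singleton v, by simpa using he⟩

theorem finite_setOf_lazyCost [Finite V] (P : ShortestPathProblem V) :
    {c | ∃ p, P.IsPathFromSource p ∧ P.lazyCost p = c}.Finite := by
  classical
  have := Fintype.ofFinite V
  refine (Set.finite_range fun p : {p : List V // p.Nodup} => P.lazyCost p).subset ?_
  rintro _ ⟨p, hp, rfl⟩
  exact ⟨⟨p, hp.2.1⟩, rfl⟩

end ShortestPathProblem

namespace LRAStar

theorem exists_reflTransGen_forall_not {S β : Type*} [Preorder β] {r : S → S → Prop} {a : S}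
    (f : S → β) (hfin : (f '' {b | Relation.ReflTransGen r a b}).Finite)
    (hlt : ∀ b c, Relation.ReflTransGen r a b → r b c → f b < f c) :
    ∃ b, Relation.ReflTransGen r a b ∧ ∀ c, ¬ r b c := by
  obtain ⟨_, ⟨b, hb, rfl⟩, hmax⟩ := hfin.exists_maximal ⟨f a, a, .refl, rfl⟩
  exact ⟨b, hb, fun c hbc => (hlt b c hb hbc).not_ge
    (hmax ⟨c, hb.tail hbc, rfl⟩ (hlt b c hb hbc).le)⟩

variable {V : Type*} {P : ShortestPathProblem V} {α : ℕ∞} {s s' : State V} {u v x y : V}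
  {m n k : Node V}

/-- The entry of a child of `u` in the search tree, if `n` is the entry of `u` and the edge to the
child has lazy estimate `w` and is not evaluated. -/
def Node.extend (u : V) (n : Node V) (w : ℝ) : Node V :=
  ⟨some u, n.c, n.l + w, n.b + 1⟩

theorem Node.key_extend (u : V) (n : Node V) (w : ℝ) : (n.extend u w).key = n.key + w :=
  (add_assoc _ _ _).symm

/-- The entry that arises from `n` when an edge with lazy estimate `w` moves from the tail of the
tree path to its head. The budget is meant to be positive, as the subtraction truncates. -/
def Node.advance (w : ℝ) (n : Node V) : Node V :=
  ⟨n.parent, n.c + w, n.l - w, n.b - 1⟩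

theorem Node.key_advance (w : ℝ) (n : Node V) : (n.advance w).key = n.key :=
  add_add_sub_cancel _ _ _

theorem mem_subtree_self (s : State V) (v : V) : v ∈ s.subtree v :=
  Relation.ReflTransGen.refl

theorem mem_subtree_of_parent (hn : s.tree y = some n) (hp : n.parent = some x)
    (hx : x ∈ s.subtree v) : y ∈ s.subtree v :=
  Relation.ReflTransGen.tail hx ⟨n, hn, hp⟩

theorem parent_mem_subtree (hy : y ∈ s.subtree v) (hyv : y ≠ v) (hn : s.tree y = some n)
    (hp : n.parent = some x) : x ∈ s.subtree v := by
  rcases Relation.ReflTransGen.cases_tail hy with hyv' | ⟨z, hz, n', hn', hp'⟩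
  · exact absurd hyv' hyv
  · obtain rfl := Option.some.inj (hn.symm.trans hn')
    obtain rfl := Option.some.inj (hp.symm.trans hp')
    exact hz

theorem canAttach_iff (hn : s.tree u = some n) :
    CanAttach P α s u v ↔ u ≠ P.target ∧ (n.b : ℕ∞) < α ∧ (u, v) ∈ s.edges ∧
      ∀ m, s.tree v = some m → n.key + P.lazyW (u, v) < m.key := by
  simp [CanAttach, hn]

/-- The band cannot be extended any further. -/
def BandClosed (P : ShortestPathProblem V) (α : ℕ∞) (s : State V) : Prop :=
  ∀ u v, ¬ CanAttach P α s u v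

theorem BandClosed.exists_key_le (hs : BandClosed P α s) (hn : s.tree u = some n)
    (ht : u ≠ P.target) (hb : (n.b : ℕ∞) < α) (he : (u, v) ∈ s.edges) :
    ∃ m, s.tree v = some m ∧ m.key ≤ n.key + P.lazyW (u, v) := by
  by_contra! hm
  exact hs u v ((canAttach_iff hn).2 ⟨ht, hb, he, hm⟩)

/-! ### The invariant of the search tree -/

/-- The vertex `u` with entry `m` is the parent of `v` with entry `n` in the search tree, and the
entries are related as they have to be: the edge `(u, v)` belongs to the tail of the tree path
to `v`, or it is evaluated and then the whole tree path to `v` is. -/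
structure IsChild (P : ShortestPathProblem V) (s : State V) (u v : V) (m n : Node V) : Prop where
  left : s.tree u = some m
  right : s.tree v = some n
  parent : n.parent = some u
  ne_target : u ≠ P.target
  mem_edges : (u, v) ∈ s.edges
  key : n.key = m.key + P.lazyW (u, v)
  budget : (n.b = m.b + 1 ∧ (u, v) ∉ s.evaluated) ∨ (m.b = 0 ∧ n.b = 0 ∧ (u, v) ∈ s.evaluated)

/-- The properties of a state that every elementary step of the algorithm preserves: the graph
has lost exactly the evaluated edges in collision, the entries of the finite search tree
describe its tree paths, and the evaluated part of the tree contains exactly the evaluated edges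
without collision and consists of shortest paths of the current graph. -/
structure TreeInvariant (P : ShortestPathProblem V) (α : ℕ∞) (s : State V) : Prop where
  mem_edges_iff : ∀ e, e ∈ s.edges ↔
    e ∈ P.edges ∧ (e ∈ s.evaluated → P.w e = (P.lazyW e : WithTop ℝ))
  finite : {v | ∃ n, s.tree v = some n}.Finite
  root : s.tree P.source = some ⟨none, 0, 0, 0⟩
  exists_isChild : ∀ v n, s.tree v = some n → v ≠ P.source → ∃ u m, IsChild P s u v m n
  left_of_mem_evaluated : ∀ u v, (u, v) ∈ s.evaluated → ∃ n, s.tree u = some n ∧ n.b = 0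
  right_of_mem_evaluated : ∀ u v, (u, v) ∈ s.evaluated → (u, v) ∈ s.edges →
    ∃ n, s.tree v = some n ∧ n.parent = some u ∧ n.b = 0
  key_le_of_budget_eq_zero : ∀ v n c, s.tree v = some n → n.b = 0 →
    P.IsWalkCost s.edges v c → n.key ≤ c
  budget_le : ∀ v n, s.tree v = some n → (n.b : ℕ∞) ≤ α

theorem IsChild.budget_eq (hc : IsChild P s u v m n) (hn : 0 < n.b) : n.b = m.b + 1 := by
  have := hc.budget
  omega

theorem IsChild.notMem_evaluated (hc : IsChild P s u v m n) (hn : 0 < n.b) :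
    (u, v) ∉ s.evaluated := by
  rcases hc.budget with ⟨-, hev⟩ | ⟨-, hn0, -⟩
  · exact hev
  · exact absurd hn0 hn.ne'

namespace TreeInvariant

theorem edges_subset (h : TreeInvariant P α s) : s.edges ⊆ P.edges :=
  fun e he => ((h.mem_edges_iff e).1 he).1

theorem exists_isChild_of_parent (h : TreeInvariant P α s) (hn : s.tree v = some n)
    (hp : n.parent = some u) : ∃ m, IsChild P s u v m n := by
  have hv : v ≠ P.source := by
    rintro rfl
    obtain rfl := Option.some.inj (h.root.symm.trans hn)
    cases hp
  obtain ⟨u', m, hc⟩ := h.exists_isChild v n hn hv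
  obtain rfl := Option.some.inj (hc.parent.symm.trans hp)
  exact ⟨m, hc⟩

theorem key_lt_of_isChild (h : TreeInvariant P α s) (hc : IsChild P s u v m n) :
    m.key < n.key := by
  rw [hc.key]
  exact lt_add_of_pos_right _ (P.lazyW_pos _ (h.edges_subset hc.mem_edges))

theorem induction (h : TreeInvariant P α s) {motive : V → Node V → Prop}
    (root : motive P.source ⟨none, 0, 0, 0⟩)
    (child : ∀ u v m n, IsChild P s u v m n → motive u m → motive v n)
    (v : V) (n : Node V) (hn : s.tree v = some n) : motive v n := by
  let keys : Set ℝ := {k | ∃ v n, s.tree v = some n ∧ n.key = k}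
  have hkeys : keys.Finite := by
    refine (h.finite.image fun v => ((s.tree v).map Node.key).getD 0).subset ?_
    rintro _ ⟨v, n, hn, rfl⟩
    exact ⟨v, ⟨n, hn⟩, by simp [hn]⟩
  have hwf : keys.WellFoundedOn (· < ·) := hkeys.wellFoundedOn
  suffices ∀ k ∈ keys, ∀ v n, s.tree v = some n → n.key = k → motive v n from
    this n.key ⟨v, n, hn, rfl⟩ v n hn rfl
  intro k hk
  apply hwf.induction hk
  rintro _ - ih v n hn rfl
  by_cases hv : v = P.source
  · subst hv
    obtain rfl := Option.some.inj (h.root.symm.trans hn)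
    exact root
  · obtain ⟨u, m, hc⟩ := h.exists_isChild v n hn hv
    exact child u v m n hc
      (ih m.key ⟨u, m, hc.left, rfl⟩ (h.key_lt_of_isChild hc) u m hc.left rfl)

theorem isWalkCost_key (h : TreeInvariant P α s) :
    ∀ v n, s.tree v = some n → P.IsWalkCost s.edges v n.key := by
  refine h.induction ?_ fun u v m n hc ih => ?_
  · simpa [Node.key] using ShortestPathProblem.IsWalkCost.nil (P := P) (E := s.edges)
  · rw [hc.key]
    exact ih.snoc hc.mem_edges

theorem key_nonneg (h : TreeInvariant P α s) (hn : s.tree v = some n) : 0 ≤ n.key :=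
  (h.isWalkCost_key v n hn).nonneg h.edges_subset

theorem exists_isPathFromSource (h : TreeInvariant P α s) : ∀ v n, s.tree v = some n →
    ∃ p, P.IsPathFromSource (p ++ [v]) ∧ P.lazyCost (p ++ [v]) = n.key ∧
      n.parent = p.getLast? ∧ ∀ x ∈ p, ∃ m, s.tree x = some m ∧ m.key < n.key := by
  refine h.induction ?_ ?_
  · exact ⟨[], ⟨rfl, by simp, by simp⟩, by simp [ShortestPathProblem.lazyCost, Node.key], rfl,
      by simp⟩
  · rintro u v m n hc ⟨p, hpath, hcost, -, hkeys⟩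
    have hlt := h.key_lt_of_isChild hc
    have hkeys' : ∀ x ∈ p ++ [u], ∃ m, s.tree x = some m ∧ m.key < n.key := by
      intro x hx
      rcases List.mem_append.1 hx with hx | hx
      · obtain ⟨k, hk, hkm⟩ := hkeys x hx
        exact ⟨k, hk, hkm.trans hlt⟩
      · rw [List.mem_singleton.1 hx]
        exact ⟨m, hc.left, hlt⟩
    have hv : v ∉ p ++ [u] := by
      intro hv
      obtain ⟨k, hk, hkn⟩ := hkeys' v hv
      obtain rfl := Option.some.inj (hk.symm.trans hc.right)
      exact lt_irrefl _ hkn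
    refine ⟨p ++ [u], hpath.append_singleton (h.edges_subset hc.mem_edges) hv, ?_,
      by simpa using hc.parent, hkeys'⟩
    rw [P.lazyCost_append_singleton_append_singleton, hcost, hc.key]

theorem eq_and_parent_eq_of_key_eq (hP : P.NoTies) {β : ℕ∞} {t : State V}
    (hs : TreeInvariant P α s) (ht : TreeInvariant P β t) (hn : s.tree x = some n)
    (hm : t.tree y = some m) (hkey : n.key = m.key) : x = y ∧ n.parent = m.parent := by
  obtain ⟨p, hp, hpn, hpx, -⟩ := hs.exists_isPathFromSource x n hn
  obtain ⟨q, hq, hqm, hqy, -⟩ := ht.exists_isPathFromSource y m hm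
  have hpq : p ++ [x] = q ++ [y] := hP _ _ hp hq (by rw [hpn, hqm, hkey])
  obtain ⟨rfl, hxy⟩ := List.append_inj' hpq rfl
  exact ⟨List.singleton_inj.1 hxy, hpx.trans hqy.symm⟩

theorem lt_of_mem_subtree (h : TreeInvariant P α s) (hx : x ∈ s.subtree v) (hxv : x ≠ v) :
    ∃ m n, s.tree v = some m ∧ s.tree x = some n ∧ m.key < n.key ∧ (0 < m.b → m.b < n.b) := by
  induction hx with
  | refl => exact absurd rfl hxv
  | @tail y z _ hz ih =>
    obtain ⟨n, hn, hp⟩ := hz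
    obtain ⟨m, hc⟩ := h.exists_isChild_of_parent hn hp
    have hkey := h.key_lt_of_isChild hc
    have hb := hc.budget
    by_cases hyv : y = v
    · subst hyv
      exact ⟨m, n, hc.left, hn, hkey, by omega⟩
    · obtain ⟨m', n', hm', hn', hkey', hb'⟩ := ih hyv
      obtain rfl := Option.some.inj (hc.left.symm.trans hn')
      exact ⟨m', n, hm', hn, hkey'.trans hkey, by omega⟩

theorem key_le_of_mem_subtree (h : TreeInvariant P α s) (hx : x ∈ s.subtree v)
    (hm : s.tree v = some m) (hn : s.tree x = some n) : m.key ≤ n.key := by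
  by_cases hxv : x = v
  · subst hxv
    obtain rfl := Option.some.inj (hm.symm.trans hn)
    exact le_rfl
  · obtain ⟨m', n', hm', hn', hlt, -⟩ := h.lt_of_mem_subtree hx hxv
    obtain rfl := Option.some.inj (hm.symm.trans hm')
    obtain rfl := Option.some.inj (hn.symm.trans hn')
    exact hlt.le

theorem budget_lt_of_mem_subtree (h : TreeInvariant P α s) (hx : x ∈ s.subtree v) (hxv : x ≠ v)
    (hm : s.tree v = some m) (hn : s.tree x = some n) (hb : 0 < m.b) : m.b < n.b := by
  obtain ⟨m', n', hm', hn', -, hlt⟩ := h.lt_of_mem_subtree hx hxv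
  obtain rfl := Option.some.inj (hm.symm.trans hm')
  obtain rfl := Option.some.inj (hn.symm.trans hn')
  exact hlt hb

theorem notMem_subtree_of_budget_eq_zero (h : TreeInvariant P α s)
    (hv : ∀ m, s.tree v = some m → 0 < m.b) (hn : s.tree x = some n) (hb : n.b = 0) :
    x ∉ s.subtree v := by
  intro hx
  by_cases hxv : x = v
  · subst hxv
    exact (hv n hn).ne' hb
  · obtain ⟨m, -, hm, -⟩ := h.lt_of_mem_subtree hx hxv
    have := h.budget_lt_of_mem_subtree hx hxv hm hn (hv m hm)
    omega

theorem eq_target_of_mem_subtree_target (h : TreeInvariant P α s)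
    (hx : x ∈ s.subtree P.target) : x = P.target := by
  rcases Relation.ReflTransGen.cases_head hx with htx | ⟨y, ⟨n, hn, hp⟩, -⟩
  · exact htx.symm
  · obtain ⟨m, hc⟩ := h.exists_isChild_of_parent hn hp
    exact absurd rfl hc.ne_target

end TreeInvariant

theorem treeInvariant_init (P : ShortestPathProblem V) (α : ℕ∞) :
    TreeInvariant P α (init P) := by
  have tree_eq_some : ∀ v n, (init P).tree v = some n → v = P.source ∧ n = ⟨none, 0, 0, 0⟩ := by
    intro v n hn
    simp only [init, Option.ite_none_right_eq_some, Option.some_inj] at hn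
    exact ⟨hn.1, hn.2.symm⟩
  refine ⟨by simp [init], ?_, by simp [init], ?_, by simp [init], by simp [init], ?_, ?_⟩
  · exact (Set.finite_singleton P.source).subset fun v ⟨n, hn⟩ => (tree_eq_some v n hn).1
  · exact fun v n hn hv => absurd (tree_eq_some v n hn).1 hv
  · intro v n c hn _ hc
    obtain ⟨-, rfl⟩ := tree_eq_some v n hn
    simpa [Node.key] using hc.nonneg subset_rfl
  · intro v n hn
    obtain ⟨-, rfl⟩ := tree_eq_some v n hn
    simp

/-! ### Extending the band -/

theorem attach_tree_self : (attach P s u n v).tree v = some (n.extend u (P.lazyW (u, v))) := by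
  simp [attach, Node.extend]

theorem attach_tree_of_notMem (hx : x ∉ s.subtree v) :
    (attach P s u n v).tree x = s.tree x := by
  have hxv : x ≠ v := fun hxv => hx (hxv ▸ mem_subtree_self s v)
  simp only [attach, if_neg hxv, if_neg hx]

theorem attach_tree_eq_some (hk : (attach P s u n v).tree x = some k) :
    (x = v ∧ k = n.extend u (P.lazyW (u, v))) ∨ (x ∉ s.subtree v ∧ s.tree x = some k) := by
  by_cases hxv : x = v
  · subst hxv
    exact Or.inl ⟨rfl, Option.some.inj (hk.symm.trans attach_tree_self)⟩
  · by_cases hx : x ∈ s.subtree v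
    · simp only [attach, if_neg hxv, if_pos hx, reduceCtorEq] at hk
    · exact Or.inr ⟨hx, (attach_tree_of_notMem hx).symm.trans hk⟩

theorem done_of_done_attach (hd : Done P (attach P s u n v)) : Done P s := by
  obtain ⟨k, hk, hk0⟩ := hd
  rcases attach_tree_eq_some hk with ⟨-, rfl⟩ | ⟨-, hk'⟩
  · exact absurd hk0 n.b.succ_ne_zero
  · exact ⟨k, hk', hk0⟩

theorem done_of_done_attachSteps (hs : Relation.ReflTransGen (AttachStep P α) s s')
    (hd : Done P s') : Done P s := by
  induction hs with
  | refl => exact hd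
  | tail _ hstep ih =>
    obtain ⟨u, v, n, -, -, rfl⟩ := hstep
    exact ih (done_of_done_attach hd)

theorem evaluated_eq_of_attachSteps (hs : Relation.ReflTransGen (AttachStep P α) s s') :
    s'.evaluated = s.evaluated := by
  induction hs with
  | refl => rfl
  | tail _ hstep ih =>
    obtain ⟨u, v, n, -, -, rfl⟩ := hstep
    exact ih

theorem IsChild.attach_of_notMem (hc : IsChild P s x y m k) (hy : y ∉ s.subtree v) :
    IsChild P (attach P s u n v) x y m k where
  __ := hc
  left := (attach_tree_of_notMem fun hx =>
    hy (mem_subtree_of_parent hc.right hc.parent hx)).trans hc.left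
  right := (attach_tree_of_notMem hy).trans hc.right

namespace TreeInvariant

theorem attach_key_lt (h : TreeInvariant P α s) (hn : s.tree u = some n)
    (hc : CanAttach P α s u v) (hx : x ∈ s.subtree v) (hk : s.tree x = some k) :
    n.key + P.lazyW (u, v) < k.key := by
  obtain ⟨-, -, -, hlt⟩ := (canAttach_iff hn).1 hc
  by_cases hxv : x = v
  · subst hxv
    exact hlt k hk
  · obtain ⟨m, -, hm, -⟩ := h.lt_of_mem_subtree hx hxv
    exact (hlt m hm).trans_le (h.key_le_of_mem_subtree hx hm hk)

theorem notMem_subtree_of_canAttach (h : TreeInvariant P α s) (hc : CanAttach P α s u v) :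
    u ∉ s.subtree v := by
  intro hu
  obtain ⟨n, hn, -, -, he, -⟩ := id hc
  have hpos := P.lazyW_pos _ (h.edges_subset he)
  have hlt := h.attach_key_lt hn hc hu hn
  linarith

theorem budget_pos_of_canAttach (h : TreeInvariant P α s) (hc : CanAttach P α s u v)
    (hm : s.tree v = some m) : 0 < m.b := by
  obtain ⟨n, hn, -, -, he, hlt⟩ := hc
  by_contra! hb
  exact (hlt m hm).not_ge (h.key_le_of_budget_eq_zero v m _ hm (Nat.le_zero.1 hb)
    ((h.isWalkCost_key u n hn).snoc he))

theorem attach_tree_of_budget_eq_zero (h : TreeInvariant P α s) (hc : CanAttach P α s u v)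
    (hk : s.tree x = some k) (hb : k.b = 0) : (attach P s u n v).tree x = some k :=
  (attach_tree_of_notMem (h.notMem_subtree_of_budget_eq_zero
    (fun _ => h.budget_pos_of_canAttach hc) hk hb)).trans hk

theorem isChild_attach_self (h : TreeInvariant P α s) (hn : s.tree u = some n)
    (hc : CanAttach P α s u v) :
    IsChild P (attach P s u n v) u v n (n.extend u (P.lazyW (u, v))) := by
  obtain ⟨ht, -, he, -⟩ := (canAttach_iff hn).1 hc
  have hev : (u, v) ∉ s.evaluated := by
    intro hev
    obtain ⟨k, hk, -, hk0⟩ := h.right_of_mem_evaluated u v hev he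
    exact (h.budget_pos_of_canAttach hc hk).ne' hk0
  exact ⟨(attach_tree_of_notMem (h.notMem_subtree_of_canAttach hc)).trans hn, attach_tree_self,
    rfl, ht, he, Node.key_extend u n _, Or.inl ⟨rfl, hev⟩⟩

protected theorem attach (h : TreeInvariant P α s) (hn : s.tree u = some n)
    (hc : CanAttach P α s u v) : TreeInvariant P α (attach P s u n v) := by
  refine ⟨h.mem_edges_iff, ?_, h.attach_tree_of_budget_eq_zero hc h.root rfl, ?_, ?_, ?_, ?_, ?_⟩
  · refine (h.finite.insert v).subset fun x ⟨k, hk⟩ => ?_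
    exact (attach_tree_eq_some hk).imp And.left fun hk' => ⟨k, hk'.2⟩
  · intro x k hk hx
    rcases attach_tree_eq_some hk with ⟨rfl, rfl⟩ | ⟨hxv, hk'⟩
    · exact ⟨u, n, h.isChild_attach_self hn hc⟩
    · obtain ⟨y, m, hyx⟩ := h.exists_isChild x k hk' hx
      exact ⟨y, m, hyx.attach_of_notMem hxv⟩
  · intro a b hab
    obtain ⟨k, hk, hk0⟩ := h.left_of_mem_evaluated a b hab
    exact ⟨k, h.attach_tree_of_budget_eq_zero hc hk hk0, hk0⟩
  · intro a b hab hab'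
    obtain ⟨k, hk, hp, hk0⟩ := h.right_of_mem_evaluated a b hab hab'
    exact ⟨k, h.attach_tree_of_budget_eq_zero hc hk hk0, hp, hk0⟩
  · intro x k c hk hk0 hw
    rcases attach_tree_eq_some hk with ⟨-, rfl⟩ | ⟨-, hk'⟩
    · exact absurd hk0 n.b.succ_ne_zero
    · exact h.key_le_of_budget_eq_zero x k c hk' hk0 hw
  · intro x k hk
    rcases attach_tree_eq_some hk with ⟨-, rfl⟩ | ⟨-, hk'⟩
    · simpa [Node.extend] using Order.add_one_le_of_lt ((canAttach_iff hn).1 hc).2.1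
    · exact h.budget_le x k hk'

theorem attachSteps (h : TreeInvariant P α s)
    (hs : Relation.ReflTransGen (AttachStep P α) s s') : TreeInvariant P α s' := by
  induction hs with
  | refl => exact h
  | tail _ hstep ih =>
    obtain ⟨u, v, n, hn, hc, rfl⟩ := hstep
    exact ih.attach hn hc

end TreeInvariant

/-- The vertices of the search tree, each of them together with its key. The order is reversed so
that in the colexicographic order of finite sets the smallest key decides: this is the quantity
that grows while the band is extended. The vertices only make nodes with equal keys distinct. -/
def keyedVertices [Fintype V] (s : State V) : Finset (ℝ ×ₗ V)ᵒᵈ :=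
  Finset.univ.filterMap (fun v => (s.tree v).map fun n => OrderDual.toDual (toLex (n.key, v)))
    (by
      intro v v' a ha ha'
      obtain ⟨n, -, rfl⟩ := Option.map_eq_some_iff.1 ha
      obtain ⟨n', -, hn'⟩ := Option.map_eq_some_iff.1 ha'
      exact congrArg (fun a => (ofLex (OrderDual.ofDual a)).2) hn'.symm)

theorem mem_keyedVertices [Fintype V] {a : (ℝ ×ₗ V)ᵒᵈ} : a ∈ keyedVertices s ↔
    ∃ v n, s.tree v = some n ∧ OrderDual.toDual (toLex (n.key, v)) = a := by
  simp [keyedVertices]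

theorem TreeInvariant.toColex_keyedVertices_lt_attach [Fintype V] [LinearOrder V]
    (h : TreeInvariant P α s) (hn : s.tree u = some n) (hc : CanAttach P α s u v) :
    toColex (keyedVertices s) < toColex (keyedVertices (attach P s u n v)) := by
  rw [Finset.Colex.toColex_lt_toColex_iff_exists_forall_lt]
  refine ⟨OrderDual.toDual (toLex (n.key + P.lazyW (u, v), v)),
    mem_keyedVertices.2 ⟨v, _, attach_tree_self, by rw [Node.key_extend]⟩, ?_, ?_⟩
  · intro hmem
    obtain ⟨x, k, hk, hkx⟩ := mem_keyedVertices.1 hmem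
    obtain ⟨hkey, rfl⟩ := Prod.ext_iff.1 (toLex_inj.1 (OrderDual.toDual_inj.1 hkx))
    exact (h.attach_key_lt hn hc (mem_subtree_self s x) hk).ne' hkey
  · intro a ha ha'
    obtain ⟨x, k, hk, rfl⟩ := mem_keyedVertices.1 ha
    have hx : x ∈ s.subtree v := by
      by_contra hx
      exact ha' (mem_keyedVertices.2 ⟨x, k, (attach_tree_of_notMem hx).trans hk, rfl⟩)
    exact OrderDual.toDual_lt_toDual.2 (Prod.Lex.toLex_lt_toLex.2
      (Or.inl (h.attach_key_lt hn hc hx hk)))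

theorem TreeInvariant.exists_extendBand [Finite V] (h : TreeInvariant P α s) :
    ∃ s', ExtendBand P α s s' := by
  have := Fintype.ofFinite V
  let _ : LinearOrder V := IsWellOrder.linearOrder WellOrderingRel
  have hfin : ((OrderDual.toDual ∘ toLex : ℝ × V → (ℝ ×ₗ V)ᵒᵈ) ''
      ({c | ∃ p, P.IsPathFromSource p ∧ P.lazyCost p = c} ×ˢ Set.univ)).Finite :=
    (P.finite_setOf_lazyCost.prod Set.finite_univ).image _
  have hbound : ∀ s', Relation.ReflTransGen (AttachStep P α) s s' →
      keyedVertices s' ⊆ hfin.toFinset := by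
    intro s' hs' a ha
    obtain ⟨v, n, hn, rfl⟩ := mem_keyedVertices.1 ha
    obtain ⟨p, hp, hpn, -⟩ := (h.attachSteps hs').exists_isPathFromSource v n hn
    exact hfin.mem_toFinset.2 ⟨(n.key, v), ⟨⟨p ++ [v], hp, hpn⟩, Set.mem_univ v⟩, rfl⟩
  obtain ⟨s', hs', hterminal⟩ : ∃ s', Relation.ReflTransGen (AttachStep P α) s s' ∧
      ∀ s'', ¬ AttachStep P α s' s'' := by
    refine exists_reflTransGen_forall_not (fun s => toColex (keyedVertices s)) ?_ ?_
    · refine ((Set.finite_Iic hfin.toFinset).image toColex).subset ?_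
      rintro _ ⟨s', hs', rfl⟩
      exact ⟨_, hbound s' hs', rfl⟩
    · rintro s₁ _ hs₁ ⟨u, v, n, hn, hc, rfl⟩
      exact (h.attachSteps hs₁).toColex_keyedVertices_lt_attach hn hc
  exact ⟨s', hs', fun u v hc => hterminal _ ⟨u, v, _, hc.choose_spec.1, hc, rfl⟩⟩

/-! ### Evaluating an edge -/

theorem evaluate_evaluated : (evaluate P s u v).evaluated = insert (u, v) s.evaluated := by
  unfold evaluate
  split_ifs <;> rfl

theorem mem_evaluate_evaluated_of_ne {e : V × V} (he : e ≠ (u, v)) :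
    e ∈ (evaluate P s u v).evaluated ↔ e ∈ s.evaluated := by
  rw [evaluate_evaluated, Set.mem_insert_iff, or_iff_right he]

theorem mem_evaluate_edges_of_ne {e : V × V} (he : e ≠ (u, v)) :
    e ∈ (evaluate P s u v).edges ↔ e ∈ s.edges := by
  unfold evaluate
  split_ifs <;> simp [he]

theorem mem_evaluate_edges_self :
    (u, v) ∈ (evaluate P s u v).edges ↔
      (u, v) ∈ s.edges ∧ P.w (u, v) = (P.lazyW (u, v) : WithTop ℝ) := by
  unfold evaluate
  split_ifs with hw <;> simp [hw]

theorem evaluate_edges_subset : (evaluate P s u v).edges ⊆ s.edges := by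
  unfold evaluate
  split_ifs
  · exact subset_rfl
  · exact Set.sdiff_subset

theorem evaluate_tree_of_notMem (hx : x ∉ s.subtree v) :
    (evaluate P s u v).tree x = s.tree x := by
  unfold evaluate
  split_ifs <;> simp only [if_neg hx]

theorem evaluate_tree_of_mem (hx : x ∈ s.subtree v)
    (hw : P.w (u, v) = (P.lazyW (u, v) : WithTop ℝ)) (hk : s.tree x = some k) :
    (evaluate P s u v).tree x = some (k.advance (P.lazyW (u, v))) := by
  simp only [evaluate, if_pos hw, if_pos hx, hk, Option.map_some, Node.advance]

theorem evaluate_tree_eq_some (hk : (evaluate P s u v).tree x = some k) :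
    (x ∉ s.subtree v ∧ s.tree x = some k) ∨
      (x ∈ s.subtree v ∧ P.w (u, v) = (P.lazyW (u, v) : WithTop ℝ) ∧
        ∃ n, s.tree x = some n ∧ k = n.advance (P.lazyW (u, v))) := by
  by_cases hx : x ∈ s.subtree v
  · by_cases hw : P.w (u, v) = (P.lazyW (u, v) : WithTop ℝ)
    · simp only [evaluate, if_pos hw, if_pos hx, Option.map_eq_some_iff] at hk
      obtain ⟨n, hn, rfl⟩ := hk
      exact Or.inr ⟨hx, hw, n, hn, rfl⟩
    · simp only [evaluate, if_neg hw, if_pos hx, reduceCtorEq] at hk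
  · exact Or.inl ⟨hx, (evaluate_tree_of_notMem hx).symm.trans hk⟩

theorem IsChild.evaluate_of_notMem (hc : IsChild P s x y m k) (hy : y ∉ s.subtree v) :
    IsChild P (evaluate P s u v) x y m k := by
  have hne : (x, y) ≠ (u, v) := by
    rintro ⟨⟩
    exact hy (mem_subtree_self s _)
  have hx : x ∉ s.subtree v := fun hx => hy (mem_subtree_of_parent hc.right hc.parent hx)
  refine { hc with
    left := (evaluate_tree_of_notMem hx).trans hc.left
    right := (evaluate_tree_of_notMem hy).trans hc.right
    mem_edges := (mem_evaluate_edges_of_ne hne).2 hc.mem_edges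
    budget := ?_ }
  rw [mem_evaluate_evaluated_of_ne hne]
  exact hc.budget

theorem IsChild.evaluate_of_mem (hc : IsChild P s x y m k) (hx : x ∈ s.subtree v) (hyv : y ≠ v)
    (hm : 0 < m.b) (hw : P.w (u, v) = (P.lazyW (u, v) : WithTop ℝ)) :
    IsChild P (evaluate P s u v) x y (m.advance (P.lazyW (u, v)))
      (k.advance (P.lazyW (u, v))) := by
  have hne : (x, y) ≠ (u, v) := fun hxy => hyv (Prod.ext_iff.1 hxy).2
  have hy : y ∈ s.subtree v := mem_subtree_of_parent hc.right hc.parent hx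
  refine ⟨evaluate_tree_of_mem hx hw hc.left, evaluate_tree_of_mem hy hw hc.right, hc.parent,
    hc.ne_target, (mem_evaluate_edges_of_ne hne).2 hc.mem_edges, ?_, ?_⟩
  · rw [Node.key_advance, Node.key_advance, hc.key]
  · rw [mem_evaluate_evaluated_of_ne hne]
    rcases hc.budget with ⟨hb, hev⟩ | ⟨hm0, -⟩
    · refine Or.inl ⟨?_, hev⟩
      simp only [Node.advance]
      omega
    · exact absurd hm0 hm.ne'

namespace TreeInvariant

theorem mem_evaluate_edges_iff (h : TreeInvariant P α s) (huv : (u, v) ∈ s.edges) (e : V × V) :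
    e ∈ (evaluate P s u v).edges ↔ e ∈ P.edges ∧
      (e ∈ (evaluate P s u v).evaluated → P.w e = (P.lazyW e : WithTop ℝ)) := by
  by_cases he : e = (u, v)
  · subst he
    simp [mem_evaluate_edges_self, evaluate_evaluated, huv, h.edges_subset huv]
  · rw [mem_evaluate_edges_of_ne he, mem_evaluate_evaluated_of_ne he, h.mem_edges_iff]

section FirstTailEdge

variable (h : TreeInvariant P α s) (hc : IsChild P s u v m n) (hm : m.b = 0) (hn : n.b = 1)

include h hn hc

theorem evaluate_tree_of_budget_eq_zero (hk : s.tree x = some k) (hk0 : k.b = 0) :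
    (evaluate P s u v).tree x = some k := by
  refine (evaluate_tree_of_notMem (h.notMem_subtree_of_budget_eq_zero ?_ hk hk0)).trans hk
  rintro n' hn'
  obtain rfl := Option.some.inj (hc.right.symm.trans hn')
  omega

theorem eq_of_evaluate_budget_eq_zero (hx : x ∈ s.subtree v) (hk : s.tree x = some k)
    (hk0 : (k.advance (P.lazyW (u, v))).b = 0) : x = v := by
  by_contra hxv
  have hb := h.budget_lt_of_mem_subtree hx hxv hc.right hk (by omega)
  simp only [Node.advance] at hk0
  omega

include hm

theorem isChild_evaluate_self (hw : P.w (u, v) = (P.lazyW (u, v) : WithTop ℝ)) :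
    IsChild P (evaluate P s u v) u v m (n.advance (P.lazyW (u, v))) := by
  refine ⟨h.evaluate_tree_of_budget_eq_zero hc hn hc.left hm,
    evaluate_tree_of_mem (mem_subtree_self s v) hw hc.right, hc.parent, hc.ne_target,
    mem_evaluate_edges_self.2 ⟨hc.mem_edges, hw⟩,
    (Node.key_advance _ n).trans hc.key, Or.inr ⟨hm, ?_, ?_⟩⟩
  · simp only [Node.advance, hn]
  · rw [evaluate_evaluated]
    exact Set.mem_insert _ _

theorem exists_isChild_evaluate (hk : (evaluate P s u v).tree x = some k) (hx : x ≠ P.source) :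
    ∃ y j, IsChild P (evaluate P s u v) y x j k := by
  rcases evaluate_tree_eq_some hk with ⟨hxv, hk'⟩ | ⟨hxv, hw, k, hk', rfl⟩
  · obtain ⟨y, j, hyx⟩ := h.exists_isChild x _ hk' hx
    exact ⟨y, j, hyx.evaluate_of_notMem hxv⟩
  by_cases hne : x = v
  · subst hne
    obtain rfl := Option.some.inj (hc.right.symm.trans hk')
    exact ⟨u, m, h.isChild_evaluate_self hc hm hn hw⟩
  · obtain ⟨y, j, hyx⟩ := h.exists_isChild x k hk' hx
    have hy := parent_mem_subtree hxv hne hk' hyx.parent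
    have hj : 0 < j.b := by
      have hnk := h.budget_lt_of_mem_subtree hxv hne hc.right hk' (by omega)
      have hkj := hyx.budget_eq (by omega)
      omega
    exact ⟨y, j.advance _, hyx.evaluate_of_mem hy hne hj hw⟩

theorem exists_of_mem_evaluate_evaluated {a b : V}
    (hab : (a, b) ∈ (evaluate P s u v).evaluated) (hab' : (a, b) ∈ (evaluate P s u v).edges) :
    ∃ k, (evaluate P s u v).tree b = some k ∧ k.parent = some a ∧ k.b = 0 := by
  by_cases hne : (a, b) = (u, v)
  · obtain ⟨rfl, rfl⟩ := Prod.ext_iff.1 hne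
    have hself := h.isChild_evaluate_self hc hm hn (mem_evaluate_edges_self.1 hab').2
    exact ⟨_, hself.right, hc.parent, by simp only [Node.advance, hn]⟩
  · rw [mem_evaluate_evaluated_of_ne hne] at hab
    obtain ⟨k, hk, hp, hk0⟩ := h.right_of_mem_evaluated a b hab (evaluate_edges_subset hab')
    exact ⟨k, h.evaluate_tree_of_budget_eq_zero hc hn hk hk0, hp, hk0⟩

protected theorem evaluate (hopt : ∀ c, P.IsWalkCost s.edges v c → n.key ≤ c) :
    TreeInvariant P α (evaluate P s u v) := by
  refine ⟨h.mem_evaluate_edges_iff hc.mem_edges, ?_,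
    h.evaluate_tree_of_budget_eq_zero hc hn h.root rfl,
    fun x k => h.exists_isChild_evaluate hc hm hn, ?_,
    fun a b => h.exists_of_mem_evaluate_evaluated hc hm hn, ?_, ?_⟩
  · refine h.finite.subset fun x ⟨k, hk⟩ => ?_
    rcases evaluate_tree_eq_some hk with ⟨-, hk'⟩ | ⟨-, -, k', hk', -⟩
    · exact ⟨k, hk'⟩
    · exact ⟨k', hk'⟩
  · intro a b hab
    by_cases hne : (a, b) = (u, v)
    · obtain ⟨rfl, rfl⟩ := Prod.ext_iff.1 hne
      exact ⟨m, h.evaluate_tree_of_budget_eq_zero hc hn hc.left hm, hm⟩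
    · rw [mem_evaluate_evaluated_of_ne hne] at hab
      obtain ⟨k, hk, hk0⟩ := h.left_of_mem_evaluated a b hab
      exact ⟨k, h.evaluate_tree_of_budget_eq_zero hc hn hk hk0, hk0⟩
  · intro x k c hk hk0 hwalk
    have hwalk' := hwalk.mono evaluate_edges_subset
    rcases evaluate_tree_eq_some hk with ⟨-, hk'⟩ | ⟨hxv, -, k, hk', rfl⟩
    · exact h.key_le_of_budget_eq_zero x k c hk' hk0 hwalk'
    · obtain rfl := h.eq_of_evaluate_budget_eq_zero hc hn hxv hk' hk0
      obtain rfl := Option.some.inj (hc.right.symm.trans hk')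
      exact (Node.key_advance _ n).trans_le (hopt c hwalk')
  · intro x k hk
    rcases evaluate_tree_eq_some hk with ⟨-, hk'⟩ | ⟨-, -, k, hk', rfl⟩
    · exact h.budget_le x k hk'
    · exact le_trans (Nat.cast_le.2 (Nat.sub_le k.b 1)) (h.budget_le x k hk')

end FirstTailEdge

end TreeInvariant

/-! ### The main loop -/

theorem TreeInvariant.exists_key_le_or_exists_isFrontier (h : TreeInvariant P α s)
    (hs : BandClosed P α s) {c : ℝ} (hc : P.IsWalkCost s.edges v c) :
    (∃ n, s.tree v = some n ∧ n.key ≤ c) ∨ ∃ z k, IsFrontier P α s z k ∧ k.key ≤ c := by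
  induction hc with
  | nil => exact Or.inl ⟨_, h.root, by simp [Node.key]⟩
  | @snoc u v c _ he ih =>
    have hpos := P.lazyW_pos _ (h.edges_subset he)
    rcases ih with ⟨n, hn, hnc⟩ | ⟨z, k, hz, hkc⟩
    · by_cases hu : (n.b : ℕ∞) = α ∨ u = P.target
      · exact Or.inr ⟨u, n, ⟨hn, hu⟩, by linarith⟩
      · obtain ⟨hb, ht⟩ := not_or.1 hu
        obtain ⟨m, hm, hmn⟩ := hs.exists_key_le hn ht ((h.budget_le u n hn).lt_of_ne hb) he
        exact Or.inl ⟨m, hm, by linarith⟩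
    · exact Or.inr ⟨z, k, hz, by linarith⟩

namespace IsNext

theorem key_le_of_isFrontier (hx : IsNext P α s x) (h : TreeInvariant P α s)
    (hxv : x ∈ s.subtree v) (hn : s.tree v = some n) (hk : IsFrontier P α s y k) :
    n.key ≤ k.key := by
  obtain ⟨m, hm, hmin⟩ := hx
  exact (h.key_le_of_mem_subtree hxv hn hm.1).trans (hmin y k hk)

theorem key_le_of_isWalkCost (hx : IsNext P α s x) (h : TreeInvariant P α s)
    (hs : BandClosed P α s) (hxv : x ∈ s.subtree v) (hn : s.tree v = some n) {c : ℝ}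
    (hc : P.IsWalkCost s.edges v c) : n.key ≤ c := by
  rcases h.exists_key_le_or_exists_isFrontier hs hc with ⟨m, hm, hmc⟩ | ⟨z, k, hk, hkc⟩
  · obtain rfl := Option.some.inj (hn.symm.trans hm)
    exact hmc
  · exact (hx.key_le_of_isFrontier h hxv hn hk).trans hkc

theorem key_le_of_isWalkCost_target (hx : IsNext P α s x) (h : TreeInvariant P α s)
    (hs : BandClosed P α s) (hn : s.tree x = some n) {c : ℝ}
    (hc : P.IsWalkCost s.edges P.target c) : n.key ≤ c := by
  obtain ⟨z, k, hk, hkc⟩ : ∃ z k, IsFrontier P α s z k ∧ k.key ≤ c := by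
    rcases h.exists_key_le_or_exists_isFrontier hs hc with ⟨m, hm, hmc⟩ | hz
    · exact ⟨P.target, m, ⟨hm, Or.inr rfl⟩, hmc⟩
    · exact hz
  exact (hx.key_le_of_isFrontier h (mem_subtree_self s x) hn hk).trans hkc

end IsNext

namespace TreeInvariant

theorem exists_isChild_of_isFirstTailEdge (h : TreeInvariant P α s)
    (he : IsFirstTailEdge s x u v) :
    ∃ m n, IsChild P s u v m n ∧ m.b = 0 ∧ n.b = 1 := by
  obtain ⟨-, m, n, hm, hn, hp, hm0, hn0⟩ := he
  obtain ⟨m', hc⟩ := h.exists_isChild_of_parent hn hp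
  obtain rfl := Option.some.inj (hm.symm.trans hc.left)
  exact ⟨m, n, hc, hm0, by rw [hc.budget_eq hn0, hm0]⟩

theorem evaluate_of_isNext (h : TreeInvariant P α s) (hs : BandClosed P α s)
    (hx : IsNext P α s x) (he : IsFirstTailEdge s x u v) :
    TreeInvariant P α (evaluate P s u v) := by
  obtain ⟨m, n, hc, hm, hn⟩ := h.exists_isChild_of_isFirstTailEdge he
  exact h.evaluate hc hm hn fun c => hx.key_le_of_isWalkCost h hs he.1 hc.right

theorem eq_target_of_done_evaluate (h : TreeInvariant P α s) (he : IsFirstTailEdge s x u v)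
    (hd : ¬ Done P s) (hd' : Done P (evaluate P s u v)) :
    v = P.target ∧ P.w (u, v) = (P.lazyW (u, v) : WithTop ℝ) := by
  obtain ⟨m, n, hc, -, hn⟩ := h.exists_isChild_of_isFirstTailEdge he
  obtain ⟨k, hk, hk0⟩ := hd'
  rcases evaluate_tree_eq_some hk with ⟨-, hk'⟩ | ⟨ht, hw, k, hk', rfl⟩
  · exact absurd ⟨k, hk', hk0⟩ hd
  · exact ⟨(h.eq_of_evaluate_budget_eq_zero hc hn ht hk' hk0).symm, hw⟩

theorem evaluate_target_tree_of_ne (h : TreeInvariant P α s) (hx : x ≠ P.target) :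
    (evaluate P s u P.target).tree x = s.tree x :=
  evaluate_tree_of_notMem fun hxt => hx (h.eq_target_of_mem_subtree_target hxt)

theorem bandClosed_evaluate_target (h : TreeInvariant P α s) (hs : BandClosed P α s)
    (hw : P.w (u, P.target) = (P.lazyW (u, P.target) : WithTop ℝ)) :
    BandClosed P α (evaluate P s u P.target) := by
  rintro a b ⟨n, hn, ha, hb, he, hlt⟩
  rw [h.evaluate_target_tree_of_ne ha] at hn
  obtain ⟨m, hm, hle⟩ := hs.exists_key_le hn ha hb (evaluate_edges_subset he)
  by_cases hbt : b = P.target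
  · subst hbt
    have := hlt _ (evaluate_tree_of_mem (mem_subtree_self s _) hw hm)
    rw [Node.key_advance] at this
    exact hle.not_gt this
  · exact hle.not_gt (hlt m ((h.evaluate_target_tree_of_ne hbt).trans hm))

theorem isNext_evaluate_target (h : TreeInvariant P α s) (hx : IsNext P α s P.target)
    (hw : P.w (u, P.target) = (P.lazyW (u, P.target) : WithTop ℝ)) :
    IsNext P α (evaluate P s u P.target) P.target := by
  obtain ⟨n, hn, hmin⟩ := hx
  have hn' := evaluate_tree_of_mem (mem_subtree_self s P.target) hw hn.1
  refine ⟨_, ⟨hn', Or.inr rfl⟩, fun y k hk => ?_⟩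
  by_cases hy : y = P.target
  · subst hy
    obtain rfl := Option.some.inj (hn'.symm.trans hk.1)
    exact le_rfl
  · rw [Node.key_advance]
    exact hmin y k ⟨(h.evaluate_target_tree_of_ne hy).symm.trans hk.1, hk.2⟩

end TreeInvariant

/-- The invariant of the main loop: between two iterations the band is closed, and if the target
has been reached, then it is still a frontier node with minimal key. -/
structure LoopInvariant (P : ShortestPathProblem V) (α : ℕ∞) (s : State V) : Prop
    extends TreeInvariant P α s where
  closed : BandClosed P α s
  isNext_target : Done P s → IsNext P α s P.target

theorem loopInvariant_of_extendBand_init (hs : ExtendBand P α (init P) s) :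
    LoopInvariant P α s := by
  have h := (treeInvariant_init P α).attachSteps hs.1
  refine ⟨h, hs.2, fun hd => ?_⟩
  have ht : P.target = P.source := by
    obtain ⟨n, hn, -⟩ := done_of_done_attachSteps hs.1 hd
    simp only [init, Option.ite_none_right_eq_some] at hn
    exact hn.1
  rw [ht]
  refine ⟨_, ⟨h.root, Or.inr ht.symm⟩, fun y k hk => ?_⟩
  simpa [Node.key] using h.key_nonneg hk.1

theorem Iteration.exists_evaluated_eq_insert (hi : Iteration P α s s') :
    ∃ x u v, IsNext P α s x ∧ IsFirstTailEdge s x u v ∧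
      s'.evaluated = insert (u, v) s.evaluated := by
  obtain ⟨-, x, u, v, hx, he, ⟨-, rfl⟩ | ⟨-, hs'⟩⟩ := hi
  · exact ⟨x, u, v, hx, he, evaluate_evaluated⟩
  · exact ⟨x, u, v, hx, he, (evaluated_eq_of_attachSteps hs'.1).trans evaluate_evaluated⟩

namespace LoopInvariant

theorem evaluate_of_done (h : LoopInvariant P α s) (hx : IsNext P α s x)
    (he : IsFirstTailEdge s x u v) (hd : ¬ Done P s) (hd' : Done P (evaluate P s u v)) :
    LoopInvariant P α (evaluate P s u v) := by
  obtain ⟨rfl, hw⟩ := h.eq_target_of_done_evaluate he hd hd'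
  obtain rfl := h.eq_target_of_mem_subtree_target he.1
  exact ⟨h.evaluate_of_isNext h.closed hx he, h.bandClosed_evaluate_target h.closed hw,
    fun _ => h.isNext_evaluate_target hx hw⟩

theorem iteration (h : LoopInvariant P α s) (hi : Iteration P α s s') :
    LoopInvariant P α s' := by
  obtain ⟨hd, x, u, v, hx, he, ⟨hd', rfl⟩ | ⟨hd', hs'⟩⟩ := hi
  · exact h.evaluate_of_done hx he hd hd'
  · exact ⟨(h.evaluate_of_isNext h.closed hx he).attachSteps hs'.1, hs'.2,
      fun hd => absurd (done_of_done_attachSteps hs'.1 hd) hd'⟩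

theorem iterations (h : LoopInvariant P α s)
    (hs : Relation.ReflTransGen (Iteration P α) s s') : LoopInvariant P α s' := by
  induction hs with
  | refl => exact h
  | tail _ hi ih => exact ih.iteration hi

theorem evaluated_ssubset (h : LoopInvariant P α s) (hi : Iteration P α s s') :
    s.evaluated ⊂ s'.evaluated := by
  obtain ⟨x, u, v, -, he, hins⟩ := hi.exists_evaluated_eq_insert
  obtain ⟨m, n, hc, -, hn⟩ := h.exists_isChild_of_isFirstTailEdge he
  rw [hins]
  exact Set.ssubset_insert (hc.notMem_evaluated (by omega))

end LoopInvariant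

/-! ### Existence of complete executions -/

theorem TreeInvariant.exists_isNext (h : TreeInvariant P α s) (hk : IsFrontier P α s y k) :
    ∃ x, IsNext P α s x := by
  obtain ⟨x, ⟨n, hn⟩, hmin⟩ := Set.exists_min_image {x | ∃ n, IsFrontier P α s x n}
    (fun x => ((s.tree x).map Node.key).getD 0)
    (h.finite.subset fun x ⟨n, hn⟩ => ⟨n, hn.1⟩) ⟨y, k, hk⟩
  exact ⟨x, n, hn, fun z m hm => by simpa [hn.1, hm.1] using hmin z ⟨m, hm⟩⟩

theorem TreeInvariant.exists_isFirstTailEdge (h : TreeInvariant P α s) :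
    ∀ x n, s.tree x = some n → 0 < n.b → ∃ u v, IsFirstTailEdge s x u v := by
  refine h.induction (fun h0 => absurd h0 (lt_irrefl 0)) ?_
  intro u v m n hc ih hn
  rcases Nat.eq_zero_or_pos m.b with hm | hm
  · exact ⟨u, v, mem_subtree_self s v, m, n, hc.left, hc.right, hc.parent, hm, hn⟩
  · obtain ⟨a, b, hub, hab⟩ := ih hm
    exact ⟨a, b, mem_subtree_of_parent hc.right hc.parent hub, hab⟩

theorem IsFrontier.budget_pos (hα : 1 ≤ α) (hn : IsFrontier P α s x n) (hd : ¬ Done P s) :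
    0 < n.b := by
  by_contra! hb
  have hb : n.b = 0 := Nat.le_zero.1 hb
  rcases hn with ⟨hn, rfl | rfl⟩
  · simp [hb] at hα
  · exact hd ⟨n, hn, hb⟩

theorem LoopInvariant.exists_iteration [Finite V] (hα : 1 ≤ α) (h : LoopInvariant P α s)
    (hs : ¬ Stops P α s) : ∃ s', Iteration P α s s' := by
  simp only [Stops, not_or, not_forall, not_not] at hs
  obtain ⟨hd, y, k, hk⟩ := hs
  obtain ⟨x, hx⟩ := h.exists_isNext hk
  obtain ⟨n, hn, -⟩ := id hx
  obtain ⟨u, v, he⟩ := h.exists_isFirstTailEdge x n hn.1 (hn.budget_pos hα hd)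
  by_cases hd' : Done P (LRAStar.evaluate P s u v)
  · exact ⟨_, hd, x, u, v, hx, he, Or.inl ⟨hd', rfl⟩⟩
  · obtain ⟨s', hs'⟩ := (h.evaluate_of_isNext h.closed hx he).exists_extendBand
    exact ⟨s', hd, x, u, v, hx, he, Or.inr ⟨hd', hs'⟩⟩

theorem exists_isEvaluatedSet [Finite V] (P : ShortestPathProblem V) (hα : 1 ≤ α) :
    ∃ E, IsEvaluatedSet P α E := by
  obtain ⟨s₀, hs₀⟩ := (treeInvariant_init P α).exists_extendBand
  have h : ∀ s, Relation.ReflTransGen (Iteration P α) s₀ s → LoopInvariant P α s :=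
    fun s => (loopInvariant_of_extendBand_init hs₀).iterations
  obtain ⟨s, hs, hterminal⟩ := exists_reflTransGen_forall_not State.evaluated (Set.toFinite _)
    fun s s' hs hi => (h s hs).evaluated_ssubset hi
  refine ⟨s.evaluated, s₀, s, hs₀, hs, ?_, rfl⟩
  by_contra hstops
  obtain ⟨_, hi⟩ := (h s hs).exists_iteration hα hstops
  exact hterminal _ hi

/-! ### Comparison of two lookaheads -/

section Comparison

variable {β : ℕ∞} {t : State V} {n' m' k' : Node V}

namespace TreeInvariant

theorem edges_anti (hs : TreeInvariant P α s) (ht : TreeInvariant P β t)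
    (hev : s.evaluated ⊆ t.evaluated) : t.edges ⊆ s.edges := fun e he =>
  have he' := (ht.mem_edges_iff e).1 he
  (hs.mem_edges_iff e).2 ⟨he'.1, fun hes => he'.2 (hev hes)⟩

theorem mem_edges_of_notMem_evaluated (hs : TreeInvariant P α s) (ht : TreeInvariant P β t)
    {e : V × V} (he : e ∈ s.edges) (het : e ∉ t.evaluated) : e ∈ t.edges :=
  (ht.mem_edges_iff e).2 ⟨hs.edges_subset he, fun h => absurd h het⟩

theorem exists_key_eq_of_budget_eq_zero (hs : TreeInvariant P α s) (ht : TreeInvariant P β t)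
    (hev : s.evaluated ⊆ t.evaluated) : ∀ v n, s.tree v = some n → n.b = 0 →
      ∃ n', t.tree v = some n' ∧ n'.b = 0 ∧ n'.key = n.key := by
  refine hs.induction (fun _ => ⟨_, ht.root, rfl, rfl⟩) ?_
  intro u v m n hc ih hn
  rcases hc.budget with ⟨hb, -⟩ | ⟨hm, -, huv⟩
  · omega
  · obtain ⟨m', hm', -, hkey⟩ := ih hm
    have he := (hs.mem_edges_iff _).1 hc.mem_edges
    obtain ⟨n', hn', hp, hn0⟩ := ht.right_of_mem_evaluated u v (hev huv)
      ((ht.mem_edges_iff _).2 ⟨he.1, fun _ => he.2 huv⟩)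
    obtain ⟨m'', hc'⟩ := ht.exists_isChild_of_parent hn' hp
    obtain rfl := Option.some.inj (hm'.symm.trans hc'.left)
    exact ⟨n', hn', hn0, by rw [hc'.key, hkey, hc.key]⟩

theorem exists_key_eq_and_budget_eq_of_isChild (hP : P.NoTies) (hs : TreeInvariant P α s)
    (ht : TreeInvariant P β t) (htb : BandClosed P β t) (hev : s.evaluated ⊆ t.evaluated)
    (hc : IsChild P s u v m n) (hn : 0 < n.b) (hopt : ∀ c, P.IsWalkCost s.edges v c → n.key ≤ c)
    (huv : (u, v) ∉ t.evaluated) (hm' : t.tree u = some m') (hkey : m'.key = m.key)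
    (hb : m'.b = m.b) (hβ : (m'.b : ℕ∞) ≠ β) :
    ∃ n', t.tree v = some n' ∧ n'.key = n.key ∧ n'.b = n.b := by
  obtain ⟨n', hn', hle⟩ := htb.exists_key_le hm' hc.ne_target
    ((ht.budget_le u m' hm').lt_of_ne hβ) (hs.mem_edges_of_notMem_evaluated ht hc.mem_edges huv)
  have hkey' : n'.key = n.key := by
    refine le_antisymm (by rwa [hkey, ← hc.key] at hle) (hopt _ ?_)
    exact (ht.isWalkCost_key v n' hn').mono (hs.edges_anti ht hev)
  obtain ⟨-, hp⟩ := ht.eq_and_parent_eq_of_key_eq hP hs hn' hc.right hkey'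
  obtain ⟨m'', hc'⟩ := ht.exists_isChild_of_parent hn' (hp.trans hc.parent)
  obtain rfl := Option.some.inj (hm'.symm.trans hc'.left)
  refine ⟨n', hn', hkey', ?_⟩
  rcases hc'.budget with ⟨hb', -⟩ | ⟨-, -, huv'⟩
  · rw [hb', hb, hc.budget_eq hn]
  · exact absurd huv' huv

theorem exists_isFrontier_of_mem_subtree (hP : P.NoTies) (hαβ : β ≤ α)
    (hs : TreeInvariant P α s) (hsb : BandClosed P α s) (ht : TreeInvariant P β t)
    (htb : BandClosed P β t) (hev : s.evaluated ⊆ t.evaluated) (hx : IsNext P α s x)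
    (hn : s.tree x = some n) (hxv : x ∈ s.subtree v) :
    ∀ k k', s.tree v = some k → t.tree v = some k' → k'.key = k.key → k'.b = k.b → 0 < k.b →
      ∃ y j, IsFrontier P β t y j ∧ 0 < j.b ∧ j.key ≤ n.key := by
  induction hxv using Relation.ReflTransGen.head_induction_on with
  | refl =>
    intro k k' hk hk' hkey hb hpos
    obtain ⟨nx, ⟨hnx, hfrontier⟩, -⟩ := hx
    obtain rfl := Option.some.inj (hnx.symm.trans hn)
    obtain rfl := Option.some.inj (hnx.symm.trans hk)
    refine ⟨x, k', ⟨hk', hfrontier.imp_left fun hα => ?_⟩, hb ▸ hpos, hkey.le⟩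
    exact (ht.budget_le x k' hk').antisymm (by rwa [hb, hα])
  | @head v w hvw hwx ih =>
    intro k k' hk hk' hkey hb hpos
    obtain ⟨l, hl, hp⟩ := hvw
    obtain ⟨k₀, hc⟩ := hs.exists_isChild_of_parent hl hp
    obtain rfl := Option.some.inj (hk.symm.trans hc.left)
    have hlpos : 0 < l.b := by
      have := hc.budget
      omega
    by_cases hβ : (k'.b : ℕ∞) = β
    · refine ⟨v, k', ⟨hk', Or.inl hβ⟩, hb ▸ hpos, ?_⟩
      exact hkey ▸ (hs.key_lt_of_isChild hc).le.trans (hs.key_le_of_mem_subtree hwx hl hn)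
    · have hvw : (v, w) ∉ t.evaluated := by
        intro hvw
        obtain ⟨j, hj, hj0⟩ := ht.left_of_mem_evaluated v w hvw
        obtain rfl := Option.some.inj (hk'.symm.trans hj)
        omega
      obtain ⟨l', hl', hkey', hb'⟩ := hs.exists_key_eq_and_budget_eq_of_isChild hP ht htb hev hc
        hlpos (fun c => hx.key_le_of_isWalkCost hs hsb hwx hl) hvw hk' hkey hb hβ
      exact ih l l' hl hl' hkey' hb' hlpos

end TreeInvariant

namespace LoopInvariant

theorem lt_key_of_stops (hP : P.NoTies) (hs : LoopInvariant P α s) (ht : LoopInvariant P β t)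
    (hev : s.evaluated ⊆ t.evaluated) (hstops : Stops P β t) (hx : IsNext P α s x)
    (hn : s.tree x = some n) (hk : IsFrontier P β t y k) (hpos : 0 < k.b) : n.key < k.key := by
  by_contra! hle
  have hd : Done P t := hstops.resolve_right fun hnone => hnone y k hk
  obtain ⟨m, hm, hmin⟩ := ht.isNext_target hd
  obtain ⟨m', hm', hm0⟩ := hd
  obtain rfl := Option.some.inj (hm.1.symm.trans hm')
  have hnm : n.key ≤ m.key := hx.key_le_of_isWalkCost_target hs.toTreeInvariant hs.closed hn
    ((ht.isWalkCost_key _ m hm').mono (hs.edges_anti ht.toTreeInvariant hev))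
  have hkm : k.key = m.key := (hle.trans hnm).antisymm (hmin y k hk)
  obtain ⟨rfl, -⟩ := ht.eq_and_parent_eq_of_key_eq hP ht.toTreeInvariant hk.1 hm' hkm
  obtain rfl := Option.some.inj (hk.1.symm.trans hm')
  omega

theorem mem_evaluated (hP : P.NoTies) (hβ : 1 ≤ β) (hαβ : β ≤ α) (hs : LoopInvariant P α s)
    (ht : LoopInvariant P β t) (hev : s.evaluated ⊆ t.evaluated) (hstops : Stops P β t)
    (hx : IsNext P α s x) (he : IsFirstTailEdge s x u v) : (u, v) ∈ t.evaluated := by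
  by_contra huv
  obtain ⟨m, n, hc, hm, hn⟩ := hs.exists_isChild_of_isFirstTailEdge he
  obtain ⟨m', hm', hm0, hmkey⟩ :=
    hs.exists_key_eq_of_budget_eq_zero ht.toTreeInvariant hev u m hc.left hm
  have hmβ : (m'.b : ℕ∞) ≠ β := by
    rintro rfl
    simp [hm0] at hβ
  obtain ⟨n', hn', hnkey, hnb⟩ := hs.exists_key_eq_and_budget_eq_of_isChild hP
    ht.toTreeInvariant ht.closed hev hc (by omega)
    (fun c => hx.key_le_of_isWalkCost hs.toTreeInvariant hs.closed he.1 hc.right)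
    huv hm' hmkey (hm0.trans hm.symm) hmβ
  obtain ⟨nx, hnx, -⟩ := id hx
  obtain ⟨y, j, hj, hpos, hle⟩ := hs.exists_isFrontier_of_mem_subtree hP hαβ hs.closed
    ht.toTreeInvariant ht.closed hev hx hnx.1 he.1 n n' hc.right hn' hnkey hnb (by omega)
  exact hle.not_gt (hs.lt_key_of_stops hP ht hev hstops hx hnx.1 hj hpos)

end LoopInvariant

theorem IsEvaluatedSet.subset (hP : P.NoTies) (hβ : 1 ≤ β) (hαβ : β ≤ α) {E F : Set (V × V)}
    (hE : IsEvaluatedSet P α E) (hF : IsEvaluatedSet P β F) : E ⊆ F := by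
  obtain ⟨s₀, s, hs₀, hs, -, rfl⟩ := hE
  obtain ⟨t₀, t, ht₀, ht, hstops, rfl⟩ := hF
  have hs₀' := loopInvariant_of_extendBand_init hs₀
  have ht' := (loopInvariant_of_extendBand_init ht₀).iterations ht
  induction hs with
  | refl =>
    rw [evaluated_eq_of_attachSteps hs₀.1]
    exact Set.empty_subset _
  | tail hs hi ih =>
    obtain ⟨x, u, v, hx, he, hins⟩ := hi.exists_evaluated_eq_insert
    rw [hins]
    exact Set.insert_subset
      ((hs₀'.iterations hs).mem_evaluated hP hβ hαβ ht' ih hstops hx he) ih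

end Comparison

end LRAStar

theorem mainTheorem3_general {V : Type*} (P : ShortestPathProblem V) :
    (Finite V → ∀ α : ℕ∞, 1 ≤ α → ∃ E, LRAStar.IsEvaluatedSet P α E) ∧
      (P.NoTies → ∀ α₁ α₂ : ℕ∞, 1 ≤ α₂ → α₂ ≤ α₁ → ∀ E₁ E₂,
        LRAStar.IsEvaluatedSet P α₁ E₁ → LRAStar.IsEvaluatedSet P α₂ E₂ → E₁ ⊆ E₂) :=
  ⟨fun _ _ hα => LRAStar.exists_isEvaluatedSet P hα,
    fun hP _ _ hα₂ hα _ _ hE₁ hE₂ => hE₁.subset hP hα₂ hα hE₂⟩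

theorem mainTheorem3 {V : Type*} [Finite V] (P : ShortestPathProblem V) (hP : P.NoTies)
    (α₁ α₂ : ℕ∞) (hα₂ : 1 ≤ α₂) (hα : α₂ < α₁) :
    (∃ E₁, LRAStar.IsEvaluatedSet P α₁ E₁) ∧ (∃ E₂, LRAStar.IsEvaluatedSet P α₂ E₂) ∧
      ∀ E₁ E₂, LRAStar.IsEvaluatedSet P α₁ E₁ → LRAStar.IsEvaluatedSet P α₂ E₂ → E₁ ⊆ E₂ :=
  have ⟨hexists, hsubset⟩ := mainTheorem3_general P
  ⟨hexists ‹_› α₁ (hα₂.trans hα.le), hexists ‹_› α₂ hα₂, hsubset hP α₁ α₂ hα₂ hα.le⟩
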